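/- All graphs are finite and simple. A connected dominating set of a graph $G$ is a set $D\subseteq V(G)$ such that every vertex of $G$ is in $D$ or adjacent to a vertex of $D$ and the induced subgraph $G[D]$ is connected (and nonempty); $\gamma_c(G)$ is the least cardinality of a connected dominating set, with $\gamma_c(G)=\infty$ if there is none. A graph $G$ is a maximal $3$-$\gamma_c$-vertex critical graph if $\gamma_c(G)=3$, $\gamma_c(G+uv)<3$ for every pair of distinct nonadjacent vertices $u,v$ of $G$, and $\gamma_c(G-v)<3$ for every vertex $v$ of $G$ (such a graph is automatically $2$-connected). Let $\alpha(G)$ be the independence number of $G$, and let the connectivity $\kappa(G)$ be the least cardinality of a set $S\subseteq V(G)$ such that $G-S$ is disconnected (with the usual convention $\kappa(K_n)=n-1$ for $n\ge 1$). **Theorem 4.1.** Every maximal $3$-$\gamma_c$-vertex critical graph $G$ satisfies $\alpha(G)\le\kappa(G)$. The bound is best possible: for $l\ge 2$ let $\mathcal G_1(l)$ be the graph with the $2l+1$ vertices $v,z_1,\dots,z_l,q_1,\dots,q_l$ in which $v$ is adjacent exactly to $z_1,\dots,z_l$, the vertices $z_1,\dots,z_l$ are pairwise nonadjacent, $q_1,\dots,q_l$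 are pairwise adjacent, and $z_i$ is adjacent to $q_j$ if and only if $i\ne j$. Then $\mathcal G_1(l)$ is a maximal $3$-$\gamma_c$-vertex critical graph with $\alpha(\mathcal G_1(l))=\kappa(\mathcal G_1(l))=l$. -/

import Mathlib

namespace SimpleGraph

variable {V : Type*}

/-- `D` is a connected dominating set of `G`: every vertex is in `D` or adjacent to a vertex of `D`,
and `D` induces a connected (in particular nonempty) subgraph. -/
structure IsConnectedDominatingSet (G : SimpleGraph V) (D : Finset V) : Prop where
  dominates : ∀ v : V, v ∈ D ∨ ∃ u ∈ D, G.Adj u v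
  connected : (G.induce (D : Set V)).Connected

/-- The connected domination number, the least cardinality of a connected dominating set.
It is `⊤` if there is no connected dominating set (for finite graphs: if `G` is not connected). -/
noncomputable def connectedDominationNumber (G : SimpleGraph V) : ℕ∞ :=
  ⨅ (D : Finset V) (_ : G.IsConnectedDominatingSet D), (D.card : ℕ∞)

/-- `G` has connected domination number `k`, and joining any two nonadjacent vertices
decreases it. -/
def IsEdgeCritical (G : SimpleGraph V) (k : ℕ) : Prop :=
  G.connectedDominationNumber = k ∧
    ∀ u v : V, u ≠ v → ¬ G.Adj u v → (G ⊔ edge u v).connectedDominationNumber < k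

/-- `G` has connected domination number `k`, and deleting any vertex decreases it.
As the connected domination number of a disconnected graph is `⊤`, such a graph is connected and
has no cut vertex, so that 2-connectedness need not be required separately. -/
def IsVertexCritical (G : SimpleGraph V) (k : ℕ) : Prop :=
  G.connectedDominationNumber = k ∧
    ∀ v : V, (G.induce ({v}ᶜ : Set V)).connectedDominationNumber < k

/-- A maximal `k`-vertex critical graph (for connected domination). -/
def IsMaximalVertexCritical (G : SimpleGraph V) (k : ℕ) : Prop :=
  G.IsEdgeCritical k ∧ G.IsVertexCritical k

/-- `S` is a (vertex) cut set: `G - S` is disconnected, i.e. two of its vertices are not joined by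
a walk in `G - S`. -/
def IsCutSet (G : SimpleGraph V) (S : Finset V) : Prop :=
  ¬ (G.induce ((S : Set V)ᶜ)).Preconnected

/-- The connectivity of a finite graph: the least cardinality of a set of vertices that is a cut set
or whose deletion leaves at most one vertex. For a graph that is not complete this is the least
cardinality of a cut set; the second alternative only matters for complete graphs, which have no
cut set and get the usual value `n - 1`. -/
noncomputable def vertexConnectivity (G : SimpleGraph V) : ℕ :=
  sInf {k : ℕ | ∃ S : Finset V, S.card = k ∧ (G.IsCutSet S ∨ ((S : Set V)ᶜ).Subsingleton)}

/-- The graph on a vertex `v = inl ()`, vertices `z i = inr (inl i)` and vertices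
`q i = inr (inr i)`, for `i : Fin l`: `v` is joined to all the `z i`, the `z i` are independent,
the `q i` form a clique, and `z i` is joined to `q j` exactly if `i ≠ j`. -/
def gOne (l : ℕ) : SimpleGraph (Unit ⊕ Fin l ⊕ Fin l) where
  Adj
    | .inl _, .inr (.inl _) => True
    | .inr (.inl _), .inl _ => True
    | .inr (.inl i), .inr (.inr j) => i ≠ j
    | .inr (.inr i), .inr (.inl j) => i ≠ j
    | .inr (.inr i), .inr (.inr j) => i ≠ j
    | _, _ => False
  symm := ⟨by
    rintro (_ | _ | _) (_ | _ | _) h <;> first | exact h | exact Ne.symm h⟩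
  loopless := ⟨by
    rintro (_ | _ | _) h <;> first | exact h | exact h rfl⟩

end SimpleGraph

namespace SimpleGraph

variable {V : Type*}

/-! Vertex criticality gives, for each `v`, an edge dominating exactly the vertices other than `v`.
Edge criticality gives more inside an independent set `I` with at least three elements: for distinct
`u, v` in `I` there is such an edge `uy` missing `v`, or `vy` missing `u`. If `u, v ∈ I` and `uy`
misses `v`, then `y` is adjacent to every element of `I` except `v`, so different missed vertices
have different partners `y`.

Let `S` separate `A` from `B`, and let `P`, `Q`, `T` be the parts of `I` in `A`, `B`, `S`. A partner
adjacent to vertices on both sides lies in `S`, and outside `T` because it has a neighbour in `I`.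
Counting partners in `S \ T` therefore bounds the rest of `I`. At most one `x ∈ I` has no partner
(`forall_or_exists`), and then all the other elements are missed by edges starting at `x`.

When counting alone falls short by one, the partners fill `S \ T`, and one side shrinks to a single
vertex `b`. Some vertex of `S` then dominates the closed neighbourhood of `b`, which
`exists_adj_not_adj` forbids. The case lemmas follow the sizes of `P` and `Q`;
`card_le_of_isSeparation` collects them. -/

/-- The edge `cd` dominates every vertex except `v`. -/
structure NearDominates (G : SimpleGraph V) (c d v : V) : Prop where
  adj : G.Adj c d
  ne_left : c ≠ v
  ne_right : d ≠ v
  not_adj_left : ¬ G.Adj c v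
  not_adj_right : ¬ G.Adj d v
  dominates : ∀ u, u ≠ v → u = c ∨ u = d ∨ G.Adj c u ∨ G.Adj d u

/-- The consequences of maximal `3`-vertex criticality in terms of edges that dominate all but one
vertex. -/
structure IsNearDominated (G : SimpleGraph V) : Prop where
  exists_nearDominates : ∀ v, ∃ c d, G.NearDominates c d v
  exists_of_indep : ∀ u v w, u ≠ v → u ≠ w → v ≠ w → ¬ G.Adj u v → ¬ G.Adj u w → ¬ G.Adj v w →
    ∃ y, G.NearDominates u y v ∨ G.NearDominates v y u

/-- `A` and `B` are nonempty, and together with `S` they partition the vertices of `G`, without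
edges between `A` and `B`. -/
structure IsSeparation (G : SimpleGraph V) (A S B : Finset V) : Prop where
  left_nonempty : A.Nonempty
  right_nonempty : B.Nonempty
  cover : ∀ v, v ∈ A ∨ v ∈ S ∨ v ∈ B
  left_sep : ∀ v ∈ A, v ∉ S
  right_sep : ∀ v ∈ B, v ∉ S
  left_right : ∀ v ∈ A, v ∉ B
  not_adj : ∀ a ∈ A, ∀ b ∈ B, ¬ G.Adj a b

/-! ### Basic properties of near-dominating edges and separations. -/

variable {G : SimpleGraph V}

lemma NearDominates.symm {c d v : V} (h : G.NearDominates c d v) : G.NearDominates d c v :=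
  ⟨h.adj.symm, h.ne_right, h.ne_left, h.not_adj_right, h.not_adj_left, fun u hu => by
    have := h.dominates u hu; tauto⟩

lemma IsSeparation.symm {A S B : Finset V} (h : G.IsSeparation A S B) : G.IsSeparation B S A :=
  ⟨h.right_nonempty, h.left_nonempty, fun v => by have := h.cover v; tauto, h.right_sep, h.left_sep,
    fun v hB hA => h.left_right v hA hB, fun b hb a ha hab => h.not_adj a ha b hb hab.symm⟩

/-- No closed neighbourhood is contained in another one: the edge missing `y` must dominate `b`, so
one of its ends is in the closed neighbourhood of `b` but not in that of `y`. Several cases below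
end by contradicting this. -/
lemma IsNearDominated.exists_adj_not_adj (h : G.IsNearDominated) {b y : V} (hby : b ≠ y) :
    ∃ z, (z = b ∨ G.Adj b z) ∧ z ≠ y ∧ ¬ G.Adj y z := by
  obtain ⟨c, d, hcd⟩ := h.exists_nearDominates y
  rcases hcd.dominates b hby with rfl | rfl | hb | hb
  · exact ⟨b, .inl rfl, hby, fun e => hcd.not_adj_left e.symm⟩
  · exact ⟨b, .inl rfl, hby, fun e => hcd.not_adj_right e.symm⟩
  · exact ⟨c, .inr hb.symm, hcd.ne_left, fun e => hcd.not_adj_left e.symm⟩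
  · exact ⟨d, .inr hb.symm, hcd.ne_right, fun e => hcd.not_adj_right e.symm⟩

lemma NearDominates.adj_of_indep {I : Finset V} (hI : ∀ u ∈ I, ∀ v ∈ I, ¬ G.Adj u v) {u y v w : V}
    (h : G.NearDominates u y v) (hu : u ∈ I) (hw : w ∈ I) (hwv : w ≠ v) : G.Adj y w := by
  have := h.adj
  rcases h.dominates w hwv with rfl | rfl | h1 | h1
  · exact this.symm
  · exact absurd this (hI _ hu _ hw)
  · exact absurd h1 (hI _ hu _ hw)
  · exact h1

/-- In an independent set with at least three elements at most one element `x` is not missed by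
an edge that meets the set and dominates everything else. -/
lemma IsNearDominated.forall_or_exists (h : G.IsNearDominated) {I : Finset V}
    (hI : ∀ u ∈ I, ∀ v ∈ I, ¬ G.Adj u v) (hc : 3 ≤ I.card) :
    (∀ v ∈ I, ∃ u ∈ I, ∃ y, G.NearDominates u y v) ∨
      ∃ x ∈ I, ∀ v ∈ I, v ≠ x → ∃ y, G.NearDominates x y v := by
  classical
  by_cases hx : ∀ v ∈ I, ∃ u ∈ I, ∃ y, G.NearDominates u y v
  · exact .inl hx
  · right
    push Not at hx
    obtain ⟨x, hxI, hx⟩ := hx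
    refine ⟨x, hxI, fun v hv hvx => ?_⟩
    -- Edge criticality needs a third independent vertex `w`. Of its two outcomes, an edge from `v`
    -- missing `x` is excluded by the choice of `x`.
    obtain ⟨w, hw, hwn⟩ : ∃ w ∈ I, w ∉ ({x, v} : Finset V) :=
      Finset.exists_mem_notMem_of_card_lt_card (lt_of_le_of_lt Finset.card_le_two hc)
    simp only [Finset.mem_insert, Finset.mem_singleton, not_or] at hwn
    obtain ⟨y, hy | hy⟩ := h.exists_of_indep x v w hvx.symm (Ne.symm hwn.1) (Ne.symm hwn.2)
      (hI _ hxI _ hv) (hI _ hxI _ hw) (hI _ hv _ hw)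
    · exact ⟨y, hy⟩
    · exact absurd hy (hx v hv y)

/-- An edge dominating all but one vertex meets the separator, provided that both sides contain
a vertex to be dominated. -/
lemma IsSeparation.mem_or_mem {A S B : Finset V} (hs : G.IsSeparation A S B) {a b c d v : V}
    (h : G.NearDominates c d v) (ha : a ∈ A) (hb : b ∈ B) (hav : a ≠ v) (hbv : b ≠ v) :
    c ∈ S ∨ d ∈ S := by
  have h1 := h.dominates a hav
  have h2 := h.dominates b hbv
  have h3 := hs.cover c
  have h4 := hs.cover d
  have h5 := hs.not_adj
  have h6 := h.adj
  have h7 := hs.left_right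
  have h8 : ∀ u v, G.Adj u v → G.Adj v u := fun u v => G.adj_symm
  grind

/-- Deleting at most one vertex does not disconnect. -/
lemma IsNearDominated.two_le_card (h : G.IsNearDominated) {A S B : Finset V}
    (hs : G.IsSeparation A S B) : 2 ≤ S.card := by
  by_contra! hlt
  obtain ⟨a, ha⟩ := hs.left_nonempty
  obtain ⟨b, hb⟩ := hs.right_nonempty
  rcases S.eq_empty_or_nonempty with rfl | ⟨s, hsS⟩
  -- With an empty separator, a one-vertex side would be an isolated vertex, which no edge
  -- dominates. A second vertex on the side of `a` makes `mem_or_mem` applicable to the edge missing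
  -- `a`.
  · have key : ∀ {A B : Finset V}, G.IsSeparation A ∅ B → ∀ a ∈ A, ∀ b ∈ B, ∃ a' ∈ A, a' ≠ a := by
      intro A B hs a ha b hb
      by_contra! hA
      obtain ⟨c, d, hcd⟩ := h.exists_nearDominates b
      have hac : ∀ u, G.Adj a u → False := fun u hu => by
        rcases hs.cover u with h1 | h1 | h1
        · exact G.ne_of_adj hu (hA u h1).symm
        · simp at h1
        · exact hs.not_adj a ha u h1 hu
      rcases hcd.dominates a (fun e => hs.left_right a ha (e ▸ hb)) with rfl | rfl | h1 | h1
      · exact hac _ hcd.adj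
      · exact hac _ hcd.adj.symm
      · exact hac _ h1.symm
      · exact hac _ h1.symm
    obtain ⟨a', ha', hne⟩ := key hs a ha b hb
    obtain ⟨c, d, hcd⟩ := h.exists_nearDominates a
    simpa using hs.mem_or_mem hcd ha' hb hne (fun e => hs.left_right a ha (e ▸ hb))
  · have hS : ∀ t ∈ S, t = s := fun t ht => Finset.card_le_one.1 (by omega) _ ht _ hsS
    obtain ⟨c, d, hcd⟩ := h.exists_nearDominates s
    rcases hs.mem_or_mem hcd ha hb (fun e => hs.left_sep a ha (e ▸ hsS))
      (fun e => hs.right_sep b hb (e ▸ hsS)) with h1 | h1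
    · exact hcd.ne_left (hS _ h1)
    · exact hcd.ne_right (hS _ h1)

/-! ### From criticality to near-dominating edges. -/

lemma connectedDominationNumber_lt_three_iff :
    G.connectedDominationNumber < 3 ↔
      ∃ c d, (c = d ∨ G.Adj c d) ∧ ∀ u, u = c ∨ u = d ∨ G.Adj c u ∨ G.Adj d u := by
  classical
  constructor
  · intro h
    simp only [connectedDominationNumber, iInf_lt_iff] at h
    obtain ⟨D, hD, hlt⟩ := h
    have hlt : D.card < 3 := by exact_mod_cast hlt
    obtain ⟨⟨c, hc⟩⟩ := hD.connected.nonempty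
    have hc' : c ∈ D := hc
    have hpos : 0 < D.card := Finset.card_pos.2 ⟨c, hc'⟩
    rcases (by omega : D.card = 1 ∨ D.card = 2) with h1 | h2
    · obtain ⟨x, rfl⟩ := Finset.card_eq_one.1 h1
      refine ⟨x, x, .inl rfl, fun u => ?_⟩
      simpa using hD.dominates u
    · obtain ⟨x, y, hxy, rfl⟩ := Finset.card_eq_two.1 h2
      have : Nontrivial (({x, y} : Finset V) : Set V) :=
        ⟨⟨x, by simp⟩, ⟨y, by simp⟩, by simpa using hxy⟩
      obtain ⟨⟨z, hz⟩, hadj⟩ := hD.connected.preconnected.exists_adj_of_nontrivial ⟨x, by simp⟩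
      have hadj : G.Adj x z := hadj
      have hz : z = x ∨ z = y := by simpa using hz
      refine ⟨x, y, ?_, fun u => ?_⟩
      · rcases hz with rfl | rfl
        · exact absurd rfl hadj.ne
        · exact .inr hadj
      · have := hD.dominates u
        simp only [Finset.mem_insert, Finset.mem_singleton, exists_eq_or_imp, exists_eq_left] at this
        tauto
  · rintro ⟨c, d, hcd, hdom⟩
    have hD : G.IsConnectedDominatingSet {c, d} := by
      refine ⟨fun u => ?_, ?_⟩
      · have := hdom u
        simp only [Finset.mem_insert, Finset.mem_singleton, exists_eq_or_imp, exists_eq_left]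
        tauto
      · have hpair : (({c, d} : Finset V) : Set V) = {c, d} := by simp
        rw [hpair]
        rcases hcd with rfl | hcd
        · rw [Set.pair_eq_singleton]
          exact Connected.of_subsingleton
        · exact induce_pair_connected_of_adj hcd
    have h2 : (({c, d} : Finset V).card : ℕ∞) ≤ 2 := by exact_mod_cast Finset.card_le_two
    exact (iInf₂_le _ hD).trans_lt (h2.trans_lt (by norm_num))

lemma exists_adj_of_connectedDominationNumber_eq_three (h : G.connectedDominationNumber = 3) (v : V) : ∃ w, G.Adj v w := by
  have hlt : G.connectedDominationNumber < ⊤ := by rw [h]; exact ENat.natCast_lt_top 3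
  simp only [connectedDominationNumber, iInf_lt_iff] at hlt
  obtain ⟨D, hD, -⟩ := hlt
  have h3 : (3 : ℕ∞) ≤ D.card := h ▸ iInf₂_le D hD
  have h3 : 3 ≤ D.card := by exact_mod_cast h3
  rcases hD.dominates v with hv | ⟨u, -, hu⟩
  · have : Nontrivial (D : Set V) := by
      rw [Set.nontrivial_coe_sort, Finset.nontrivial_coe, ← Finset.one_lt_card_iff_nontrivial]
      omega
    obtain ⟨⟨z, hz⟩, hadj⟩ := hD.connected.preconnected.exists_adj_of_nontrivial ⟨v, hv⟩
    exact ⟨z, hadj⟩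
  · exact ⟨u, hu.symm⟩

lemma IsMaximalVertexCritical.isNearDominated (h : G.IsMaximalVertexCritical 3) :
    G.IsNearDominated := by
  obtain ⟨⟨h3, he⟩, -, hv⟩ := h
  have h3 : G.connectedDominationNumber = 3 := h3
  have hsy : ∀ u v, G.Adj u v → G.Adj v u := fun u v => G.adj_symm
  have hno : ∀ c d, (c = d ∨ G.Adj c d) → ∃ u, u ≠ c ∧ u ≠ d ∧ ¬ G.Adj c u ∧ ¬ G.Adj d u := by
    intro c d hcd
    by_contra! hall
    refine (connectedDominationNumber_lt_three_iff.2 ⟨c, d, hcd, fun u => ?_⟩).ne h3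
    have := hall u
    tauto
  constructor
  · intro v
    obtain ⟨⟨c, hc⟩, ⟨d, hd⟩, hcd, hdom⟩ := connectedDominationNumber_lt_three_iff.1 (hv v)
    simp only [Subtype.mk.injEq, comap_adj, Function.Embedding.subtype_apply, Subtype.forall,
      Set.mem_compl_iff, Set.mem_singleton_iff] at hc hd hcd hdom
    obtain ⟨w, hw⟩ := exists_adj_of_connectedDominationNumber_eq_three h3 v
    -- A single vertex `c` dominating `G - v` would, with a neighbour `w` of `v`, dominate all of
    -- `G`.
    rcases hcd with rfl | hcd
    · exfalso
      have hcw : c = w ∨ G.Adj c w := by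
        have := hdom w hw.ne'
        tauto
      obtain ⟨u, hu1, hu2, hu3, hu4⟩ := hno c w hcw
      have := hdom u (fun e => hu4 (e ▸ hw.symm))
      tauto
    · obtain ⟨u, hu⟩ := hno c d (.inr hcd)
      refine ⟨c, d, hcd, hc, hd, ?_, ?_, hdom⟩ <;> grind
  · intro u v w huv huw hvw auv auw avw
    obtain ⟨c, d, hcd, hdom⟩ := connectedDominationNumber_lt_three_iff.1 (he u v huv auv)
    simp only [sup_adj, edge_adj] at hcd hdom
    have h1 := hno c d
    have h2 := hdom w
    -- The pair contains exactly one of `u` and `v`: with neither it would already dominate `G`, and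
    -- with no vertex outside `{u, v}` it would leave `w` undominated.
    have h3 : (c = u ∧ d ≠ v ∧ G.Adj c d ∧ d ≠ c) ∨ (c = v ∧ d ≠ u ∧ G.Adj c d ∧ d ≠ c) ∨
        (d = u ∧ c ≠ v ∧ G.Adj c d ∧ d ≠ c) ∨ (d = v ∧ c ≠ u ∧ G.Adj c d ∧ d ≠ c) := by
      clear he hv hno
      by_contra hcon
      have h4 : c = d ∨ G.Adj c d := by grind
      obtain ⟨x, hx⟩ := h1 h4
      have h5 := hdom x
      have h6 := h4.imp id (fun h => h.ne')
      grind
    rcases h3 with ⟨rfl, h3, h4, h5⟩ | ⟨rfl, h3, h4, h5⟩ | ⟨rfl, h3, h4, h5⟩ | ⟨rfl, h3, h4, h5⟩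
    · exact ⟨d, .inl ⟨h4, by grind, by grind, by grind, by grind, by grind⟩⟩
    · exact ⟨d, .inr ⟨h4, by grind, by grind, by grind, by grind, by grind⟩⟩
    · exact ⟨c, .inl ⟨h4.symm, by grind, by grind, by grind, by grind, by grind⟩⟩
    · exact ⟨c, .inr ⟨h4.symm, by grind, by grind, by grind, by grind, by grind⟩⟩

/-! ### Counting in the separator, by the position of the independent set. -/

section Cases

variable {A S B : Finset V}

/-- If distinct `v, w` shared a value, one of them, say `w`, differs from `x`; then `y w` is
adjacent to `v` while `y v` is not. At the exceptional `x` non-adjacency alone suffices, so any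
vertex not adjacent to `x` can serve there. -/
lemma injOn_of_missing {J : Finset V} {y : V → V} (x : V) (hyn : ∀ v ∈ J, ¬ G.Adj (y v) v)
    (hy : ∀ v ∈ J, v ≠ x → ∀ w ∈ J, w ≠ v → G.Adj (y v) w) : Set.InjOn y J := by
  intro v hv w hw hvw
  by_contra hne
  by_cases hvx : v = x
  · exact hyn v hv (hvw ▸ hy w hw (fun e => hne (hvx.trans e.symm)) v hv hne)
  · exact hyn w hw (hvw ▸ hy v hv hvx w hw (Ne.symm hne))

lemma card_le_of_missing {J W : Finset V} (x : V)
    (hJ : ∀ v ∈ J, ∃ y ∈ W, ¬ G.Adj y v ∧ (v ≠ x → ∀ w ∈ J, w ≠ v → G.Adj y w)) :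
    J.card ≤ W.card := by
  choose! y hyW hyn hy using hJ
  exact Finset.card_le_card_of_injOn y hyW (injOn_of_missing x hyn hy)

/-- The case of an independent set that avoids one of the sides. -/
lemma IsNearDominated.card_add_card_le (h : G.IsNearDominated) (hs : G.IsSeparation A S B)
    {P T : Finset V} (hP : P ⊆ A) (hT : T ⊆ S) (hPP : ∀ u ∈ P, ∀ v ∈ P, ¬ G.Adj u v)
    (hPT : ∀ u ∈ P, ∀ v ∈ T, ¬ G.Adj u v) (hP2 : 2 ≤ P.card) : P.card + T.card ≤ S.card := by
  classical
  by_contra! hlt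
  have hcard : (S \ T).card + T.card = S.card := Finset.card_sdiff_add_card_eq_card hT
  obtain ⟨b, hb⟩ := hs.right_nonempty
  have hcov := hs.cover
  have hAB := hs.not_adj
  have hAS := hs.left_sep
  have hBS := hs.right_sep
  have hdisj := hs.left_right
  have hbP : b ∉ P := fun hb' => hdisj b (hP hb') hb
  -- An auxiliary `b ∈ B` is adjoined to `P`: it provides the third independent vertex and forces
  -- partners of elements of `P` into `S`.
  have hI : ∀ u ∈ insert b P, ∀ v ∈ insert b P, ¬ G.Adj u v := by
    simp only [Finset.mem_insert]
    rintro u (rfl | hu) v (rfl | hv)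
    · exact G.irrefl
    · exact fun e => hAB v (hP hv) u hb e.symm
    · exact hAB u (hP hu) v hb
    · exact hPP u hu v hv
  have hbI : b ∈ insert b P := Finset.mem_insert_self b P
  have hPI : ∀ v ∈ P, v ∈ insert b P := fun v hv => Finset.mem_insert_of_mem hv
  -- a vertex that is joined to `b` and to an element of `P` lies in `S \ T`
  have hloc : ∀ y, G.Adj y b → ∀ w ∈ P, G.Adj y w → y ∈ S \ T := by
    intro y hyb w hw hyw
    rw [Finset.mem_sdiff]
    refine ⟨?_, fun hyT => hPT w hw y hyT hyw.symm⟩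
    rcases hcov y with h1 | h1 | h1
    · exact absurd hyb (hAB y h1 b hb)
    · exact h1
    · exact absurd hyw.symm (hAB w (hP hw) y h1)
  have hone : ∀ v ∈ P, (∃ u ∈ insert b P, ∃ y, G.NearDominates u y v) →
      ∃ y ∈ S \ T, ¬ G.Adj y v ∧ ∀ w ∈ P, w ≠ v → G.Adj y w := by
    rintro v hv ⟨u, hu, y, hy⟩
    obtain ⟨w, hw, hwv⟩ := Finset.exists_mem_ne (show 1 < P.card by omega) v
    refine ⟨y, hloc y (hy.adj_of_indep hI hu hbI (by grind)) w hw
      (hy.adj_of_indep hI hu (hPI w hw) hwv), hy.not_adj_right, fun w hw hwv => ?_⟩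
    exact hy.adj_of_indep hI hu (hPI w hw) hwv
  by_cases hall : ∀ v ∈ P, ∃ u ∈ insert b P, ∃ y, G.NearDominates u y v
  · have := card_le_of_missing (G := G) b fun v hv => by
      obtain ⟨y, hy1, hy2, hy3⟩ := hone v hv (hall v hv)
      exact ⟨y, hy1, hy2, fun _ => hy3⟩
    omega
  obtain hcase | ⟨x, hx, hcase⟩ := h.forall_or_exists hI
    (by rw [Finset.card_insert_of_notMem hbP]; omega)
  · exact hall fun v hv => hcase v (hPI v hv)
  have hxP : x ∈ P := by
    rcases Finset.mem_insert.1 hx with rfl | hx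
    · exact absurd (fun v hv => ⟨x, hbI, hcase v (hPI v hv) (by grind)⟩) hall
    · exact hx
  choose! y hy using hcase
  have hyI : ∀ v ∈ insert b P, v ≠ x → ∀ w ∈ insert b P, w ≠ v → G.Adj (y v) w :=
    fun v hv hvx w hw hwv => (hy v hv hvx).adj_of_indep hI hx hw hwv
  have hyS : ∀ v ∈ P.erase x, y v ∈ S \ T := by
    intro v hv
    have hv' := Finset.mem_erase.1 hv
    exact hloc _ (hyI v (hPI v hv'.2) hv'.1 b hbI (by grind)) x hxP
      (hyI v (hPI v hv'.2) hv'.1 x hx hv'.1.symm)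
  have hinj : Set.InjOn y (P.erase x : Finset V) := by
    refine injOn_of_missing (G := G) b (fun v hv => ?_) (fun v hv _ w hw hwv => ?_)
    · rw [Finset.mem_erase] at hv
      exact (hy v (hPI v hv.2) hv.1).not_adj_right
    · rw [Finset.mem_erase] at hv hw
      exact hyI v (hPI v hv.2) hv.1 w (hPI w hw.2) hwv
  -- The negated bound leaves at most `P.card - 1` vertices in `S \ T`, so the partners exhaust it.
  have himg : (P.erase x).image y = S \ T := by
    refine Finset.eq_of_subset_of_card_le (Finset.image_subset_iff.2 hyS) ?_
    rw [Finset.card_image_of_injOn hinj, Finset.card_erase_of_mem hxP]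
    omega
  have hS : ∀ s ∈ S, s ∈ T ∨ ∃ v ∈ P, v ≠ x ∧ y v = s := by
    intro s hsS
    by_cases hsT : s ∈ T
    · exact .inl hsT
    · have : s ∈ (P.erase x).image y := himg ▸ Finset.mem_sdiff.2 ⟨hsS, hsT⟩
      obtain ⟨v, hv, rfl⟩ := Finset.mem_image.1 this
      exact .inr ⟨v, (Finset.mem_erase.1 hv).2, (Finset.mem_erase.1 hv).1, rfl⟩
  have hbx : b ≠ x := fun e => hbP (e ▸ hxP)
  -- The edge from `x` to `y b` lies inside `A` and so dominates nothing in `B`; hence `B` is only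
  -- the missed vertex `b`.
  have hB : ∀ b' ∈ B, b' = b := by
    have hyb := hy b hbI hbx
    have hybS : y b ∉ S := by
      intro hmem
      rcases hS _ hmem with h1 | ⟨v, hv, hvx, hvb⟩
      · exact hPT x hxP _ h1 hyb.adj
      · exact hyb.not_adj_right (hvb ▸ hyI v (hPI v hv) hvx b hbI (by grind))
    have hybA : y b ∈ A := by
      rcases hcov (y b) with h1 | h1 | h1
      · exact h1
      · exact absurd h1 hybS
      · exact absurd hyb.adj (hAB x (hP hxP) _ h1)
    intro b' hb'
    by_contra hne
    rcases hyb.dominates b' hne with h1 | h1 | h1 | h1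
    · exact hdisj x (hP hxP) (h1 ▸ hb')
    · exact hdisj _ hybA (h1 ▸ hb')
    · exact hAB x (hP hxP) b' hb' h1
    · exact hAB _ hybA b' hb' h1
  obtain ⟨v, hv, hvx⟩ := Finset.exists_mem_ne (show 1 < P.card by omega) x
  have hyv := hy v (hPI v hv) hvx
  have hyvb : G.Adj (y v) b := hyI v (hPI v hv) hvx b hbI (by grind)
  -- The partner `u` is one of the `y v₃`, and missing `v₂` forces `v₃ = v₂`. Since `v₁` is not
  -- adjacent to `y v₁`, the latter is dominated by `y v₂`.
  have hclique : ∀ v₁ ∈ P, v₁ ≠ x → ∀ v₂ ∈ P, v₂ ≠ x → ∀ u, G.NearDominates v₁ u v₂ →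
      G.Adj (y v₂) (y v₁) := by
    intro v₁ hv₁ hv₁x v₂ hv₂ hv₂x u hu
    have huS : u ∈ S \ T := hloc u (hu.adj_of_indep hI (hPI v₁ hv₁) hbI (by grind)) v₁ hv₁
      hu.adj.symm
    rw [← himg, Finset.mem_image] at huS
    obtain ⟨v₃, hv₃, rfl⟩ := huS
    rw [Finset.mem_erase] at hv₃
    have h32 : v₃ = v₂ := by
      by_contra hne
      exact hu.not_adj_right (hyI v₃ (hPI v₃ hv₃.2) hv₃.1 v₂ (hPI v₂ hv₂) (Ne.symm hne))
    subst h32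
    have hy1 := hy v₁ (hPI v₁ hv₁) hv₁x
    have hA : y v₁ ∈ S \ T := hyS v₁ (Finset.mem_erase.2 ⟨hv₁x, hv₁⟩)
    have hAv := hAS _ (hP hv₁)
    have hAv' := hAS _ (hP hv₂)
    rw [Finset.mem_sdiff] at hA
    rcases hu.dominates (y v₁) (fun e => hAv' (e ▸ hA.1)) with h1 | h1 | h1 | h1
    · exact absurd (h1.symm ▸ hAv) (not_not_intro hA.1)
    · exact absurd (h1 ▸ hu.adj) fun e => hy1.not_adj_right e.symm
    · exact absurd h1.symm hy1.not_adj_right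
    · exact h1
  -- All neighbours of `b` lie in `S`, and `y v` dominates `S`: it is adjacent to `T` because `x` is
  -- not, and to the other partners by `hclique`.
  obtain ⟨z, hz, hzy, hyz⟩ := h.exists_adj_not_adj (b := b) (y := y v) (G.ne_of_adj hyvb).symm
  rcases hz with rfl | hbz
  · exact hyz hyvb
  have hzS : z ∈ S := by
    rcases hcov z with h1 | h1 | h1
    · exact absurd hbz.symm (hAB z h1 b hb)
    · exact h1
    · exact absurd (hB z h1) hbz.ne'
  rcases hS z hzS with h1 | ⟨w, hw, hwx, rfl⟩
  · rcases hyv.dominates z (fun e => hAS _ (hP hv) (e ▸ hzS)) with h2 | h2 | h2 | h2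
    · exact hAS _ (hP hxP) (h2 ▸ hzS)
    · exact hzy h2
    · exact hPT x hxP z h1 h2
    · exact hyz h2
  · have hvw : v ≠ w := fun e => hzy (e ▸ rfl)
    obtain ⟨u, hu | hu⟩ := h.exists_of_indep v w x hvw hvx hwx (hPP v hv w hw) (hPP v hv x hxP)
      (hPP w hw x hxP)
    · exact hyz (hclique v hv hvx w hw hwx u hu).symm
    · exact hyz (hclique w hw hwx v hv hvx u hu)

/-- The case of an independent set with a single element on one side, and none on the other. -/
lemma IsNearDominated.card_lt_of_singleton (h : G.IsNearDominated) (hs : G.IsSeparation A S B)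
    {x : V} {T : Finset V} (hx : x ∈ A) (hT : T ⊆ S) (hTT : ∀ u ∈ T, ∀ v ∈ T, ¬ G.Adj u v)
    (hxT : ∀ v ∈ T, ¬ G.Adj x v) (hT2 : 2 ≤ T.card) : T.card < S.card := by
  classical
  by_contra! hlt
  obtain rfl := Finset.eq_of_subset_of_card_le hT hlt
  have hsy : ∀ u v, G.Adj u v → G.Adj v u := fun u v => G.adj_symm
  obtain ⟨b, hb⟩ := hs.right_nonempty
  have hcov := hs.cover
  have hAB := hs.not_adj
  have hAS := hs.left_sep
  have hBS := hs.right_sep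
  have hdisj := hs.left_right
  obtain ⟨t, ht, t', ht', htt⟩ := Finset.one_lt_card.1 (show 1 < T.card by omega)
  obtain ⟨y, hy | hy⟩ := h.exists_of_indep x t t' (by grind) (by grind) htt (hxT t ht)
    (hxT t' ht') (hTT t ht t' ht')
  · have h1 := hy.dominates b (by grind)
    have h2 := hy.adj
    have h3 := hcov y
    grind
  · have hyx := hy.ne_right
    have hyT : ∀ s ∈ T, G.Adj y s := by
      intro s hsT
      have h1 := hy.dominates s (by grind)
      have h2 := hy.adj
      have h3 := hTT t ht
      grind
    -- Since `y` is adjacent to all of the separator `T`, an edge missing `y` avoids `T`; this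
    -- forces `B = {y}`.
    obtain ⟨g, k, hgk⟩ := h.exists_nearDominates y
    have hgT : g ∉ T := fun hg => hgk.not_adj_left (hyT g hg).symm
    have hkT : k ∉ T := fun hk => hgk.not_adj_right (hyT k hk).symm
    have hB : ∀ b' ∈ B, b' = y := by
      intro b' hb'
      by_contra hne
      have := hs.mem_or_mem hgk hx hb' hyx.symm hne
      tauto
    obtain rfl := hB b hb
    have hAt : ∀ a ∈ A, a ≠ x → G.Adj t a := by
      intro a ha hax
      have := hy.dominates a hax
      grind
    obtain ⟨g, k, hgk⟩ := h.exists_nearDominates t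
    -- A neighbour `g` of `b` lies in `T`, so its own neighbour `k` is `b` or in `A`. Neither is
    -- possible: `t` is adjacent to `b` and to `A` except `x`, and `x` has no neighbour in `T`.
    have key : ∀ g k, G.NearDominates g k t → ¬ G.Adj g b := by
      intro g k hgk hgb
      have hg : g ∈ T := by
        have := hcov g
        have := hgb.ne
        grind
      have := hcov k
      have h1 := hgk.adj
      have h2 := hgk.not_adj_right
      grind
    have hbt : b ≠ t := fun e => hBS b hb (e ▸ ht)
    rcases hgk.dominates b hbt with rfl | rfl | h1 | h1
    · exact hgk.not_adj_left (hyT t ht)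
    · exact hgk.not_adj_right (hyT t ht)
    · exact key _ _ hgk h1
    · exact key _ _ hgk.symm h1

/-- The case of an independent set with a single element on each side. -/
lemma IsNearDominated.card_add_two_le (h : G.IsNearDominated) (hs : G.IsSeparation A S B)
    {a b : V} {T : Finset V} (ha : a ∈ A) (hb : b ∈ B) (hT : T ⊆ S)
    (hTT : ∀ u ∈ T, ∀ v ∈ T, ¬ G.Adj u v) (haT : ∀ v ∈ T, ¬ G.Adj a v)
    (hbT : ∀ v ∈ T, ¬ G.Adj b v) (hT1 : 1 ≤ T.card) : T.card + 2 ≤ S.card := by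
  classical
  by_contra! hlt
  have hcard : (S \ T).card + T.card = S.card := Finset.card_sdiff_add_card_eq_card hT
  have hsy : ∀ u v, G.Adj u v → G.Adj v u := fun u v => G.adj_symm
  have hcov := hs.cover
  have hAB := hs.not_adj
  have hAS := hs.left_sep
  have hBS := hs.right_sep
  have hdisj := hs.left_right
  -- the edge missing `t` meets `S \ T`
  have hmiss : ∀ t ∈ T, ∃ c ∈ S \ T, ¬ G.Adj c t := by
    intro t ht
    obtain ⟨c, d, hcd⟩ := h.exists_nearDominates t
    have key : ∀ c d, G.NearDominates c d t → c ∈ S → ∃ c ∈ S \ T, ¬ G.Adj c t := by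
      intro c d hcd hc
      by_cases hcT : c ∈ T
      · refine ⟨d, ?_, hcd.not_adj_right⟩
        have h1 := hcd.dominates a (by grind)
        have h2 := hcd.dominates b (by grind)
        have h3 := hcd.adj
        have h4 := hcov d
        grind
      · exact ⟨c, Finset.mem_sdiff.2 ⟨hc, hcT⟩, hcd.not_adj_left⟩
    rcases hs.mem_or_mem hcd ha hb (by grind) (by grind) with h1 | h1
    · exact key _ _ hcd h1
    · exact key _ _ hcd.symm h1
  rcases (by omega : T.card = 1 ∨ 2 ≤ T.card) with hT1 | hT2
  · obtain ⟨t, rfl⟩ := Finset.card_eq_one.1 hT1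
    have ht : t ∈ ({t} : Finset V) := Finset.mem_singleton_self t
    have htS := hT ht
    obtain ⟨c, hc, hct⟩ := hmiss t ht
    have hScard : (S \ {t}).card ≤ 1 := by omega
    have hS : ∀ s ∈ S, s = t ∨ s = c := by
      intro s hsS
      by_contra! hne
      exact hne.2 (Finset.card_le_one.1 hScard _ (by simp [hsS, hne.1]) _ hc)
    rw [Finset.mem_sdiff, Finset.mem_singleton] at hc
    -- Here `S = {t, c}`. An edge `aw` missing `b` would lie in `A`, leaving `c` as the only
    -- possible neighbour of `b`; then `c` dominates the closed neighbourhood of `b`.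
    have key : ∀ {A B : Finset V}, G.IsSeparation A S B → ∀ a b w, a ∈ A → b ∈ B →
        ¬ G.Adj a t → ¬ G.Adj b t → ¬ G.NearDominates a w b := by
      intro A B hs a b w ha hb hat hbt hw
      have hcov := hs.cover
      have hAB := hs.not_adj
      have hAS := hs.left_sep
      have hBS := hs.right_sep
      have hdisj := hs.left_right
      have hwt : G.Adj w t := by
        have := hw.dominates t (by grind)
        have := hw.adj
        grind
      have hwA : w ∈ A := by
        have := hcov w
        have := hw.adj
        have := hwt.ne
        grind
      have hNb : ∀ z, G.Adj b z → z = c := by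
        intro z hz
        by_contra hne
        have h1 := hcov z
        have h2 := hw.dominates z hz.ne'
        grind
      have hbc : G.Adj b c := by
        obtain ⟨e, f, hef⟩ := h.exists_nearDominates t
        obtain ⟨z, hz⟩ : ∃ z, G.Adj b z := by
          rcases hef.dominates b (by grind) with rfl | rfl | h1 | h1
          · exact ⟨_, hef.adj⟩
          · exact ⟨_, hef.adj.symm⟩
          · exact ⟨_, h1.symm⟩
          · exact ⟨_, h1.symm⟩
        exact hNb z hz ▸ hz
      obtain ⟨z, rfl | hz, hzc, hcz⟩ := h.exists_adj_not_adj hbc.ne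
      · exact hcz hbc.symm
      · exact hzc (hNb z hz)
    have hat := haT t ht
    have hbt := hbT t ht
    obtain ⟨w, hw | hw⟩ := h.exists_of_indep a b t (by grind) (by grind) (by grind)
      (hAB a ha b hb) hat hbt
    · exact key hs a b w ha hb hat hbt hw
    · exact key hs.symm b a w hb ha hbt hat hw
  · have hI : ∀ u ∈ insert a (insert b T), ∀ v ∈ insert a (insert b T), ¬ G.Adj u v := by
      have hirr : ∀ u, ¬ G.Adj u u := fun u => G.irrefl
      grind
    have hbn : b ∉ T := fun hb' => hBS b hb (hT hb')
    have han : a ∉ insert b T := by grind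
    have hc3 : 3 ≤ (insert a (insert b T)).card := by
      rw [Finset.card_insert_of_notMem han, Finset.card_insert_of_notMem hbn]; omega
    have hTI : ∀ v ∈ T, v ∈ insert a (insert b T) := by grind
    have hone : ∀ v ∈ T, ∀ u ∈ insert a (insert b T), ∀ y, G.NearDominates u y v →
        y ∈ S \ T ∧ ¬ G.Adj y v ∧ ∀ w ∈ T, w ≠ v → G.Adj y w := by
      intro v hv u hu y hy
      have hya := hy.adj_of_indep hI hu (w := a) (by simp) (by grind)
      have hyb := hy.adj_of_indep hI hu (w := b) (by simp) (by grind)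
      refine ⟨?_, hy.not_adj_right, fun w hw hwv => hy.adj_of_indep hI hu (hTI w hw) hwv⟩
      have := hcov y
      grind
    -- This suffices because `T` has at least two elements.
    have hle : T.card ≤ (S \ T).card := by
      rcases h.forall_or_exists hI hc3 with hcase | ⟨x, hx, hcase⟩
      · refine card_le_of_missing (G := G) a fun v hv => ?_
        obtain ⟨u, hu, y, hy⟩ := hcase v (hTI v hv)
        have := hone v hv u hu y hy
        exact ⟨y, this.1, this.2.1, fun _ => this.2.2⟩
      · refine card_le_of_missing (G := G) x fun v hv => ?_
        by_cases hvx : v = x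
        · obtain ⟨c, hc, hcv⟩ := hmiss v hv
          exact ⟨c, hc, hcv, fun hvx' => absurd hvx hvx'⟩
        · obtain ⟨y, hy⟩ := hcase v (hTI v hv) hvx
          have := hone v hv x hx y hy
          exact ⟨y, this.1, this.2.1, fun _ => this.2.2⟩
    omega

/-- The case of an independent set with a single element on one side, and at least two on the
other. -/
lemma IsNearDominated.card_add_card_lt (h : G.IsNearDominated) (hs : G.IsSeparation A S B)
    {b : V} {P T : Finset V} (hb : b ∈ B) (hP : P ⊆ A) (hT : T ⊆ S)
    (hPP : ∀ u ∈ P, ∀ v ∈ P, ¬ G.Adj u v) (hTT : ∀ u ∈ T, ∀ v ∈ T, ¬ G.Adj u v)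
    (hPT : ∀ u ∈ P, ∀ v ∈ T, ¬ G.Adj u v) (hbT : ∀ v ∈ T, ¬ G.Adj b v) (hP2 : 2 ≤ P.card) :
    P.card + T.card < S.card := by
  classical
  by_contra! hlt
  have hsy : ∀ u v, G.Adj u v → G.Adj v u := fun u v => G.adj_symm
  have hirr : ∀ u, ¬ G.Adj u u := fun u => G.irrefl
  have hcard : (S \ T).card + T.card = S.card := Finset.card_sdiff_add_card_eq_card hT
  have hcov := hs.cover
  have hAB := hs.not_adj
  have hAS := hs.left_sep
  have hBS := hs.right_sep
  have hdisj := hs.left_right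
  have hbPT : b ∉ P ∪ T := by grind
  have hPTc : (P ∪ T).card = P.card + T.card :=
    Finset.card_union_of_disjoint (Finset.disjoint_left.2 fun v hv hv' => hAS v (hP hv) (hT hv'))
  have hI : ∀ u ∈ insert b (P ∪ T), ∀ v ∈ insert b (P ∪ T), ¬ G.Adj u v := by grind
  have hbI : b ∈ insert b (P ∪ T) := Finset.mem_insert_self _ _
  have hPI : ∀ v ∈ P ∪ T, v ∈ insert b (P ∪ T) := fun v hv => Finset.mem_insert_of_mem hv
  have hPU : ∀ v ∈ P, v ∈ P ∪ T := fun v hv => Finset.mem_union_left _ hv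
  have hloc : ∀ y, G.Adj y b → ∀ w ∈ P, G.Adj y w → y ∈ S \ T := by
    intro y hyb w hw hyw
    have := hcov y
    grind
  have hone : ∀ v ∈ P ∪ T, ∀ u ∈ insert b (P ∪ T), ∀ y, G.NearDominates u y v →
      y ∈ S \ T ∧ G.Adj y b ∧ ∀ w ∈ P ∪ T, w ≠ v → G.Adj y w := by
    intro v hv u hu y hy
    obtain ⟨w, hw, hwv⟩ := Finset.exists_mem_ne (show 1 < P.card by omega) v
    have hyb := hy.adj_of_indep hI hu hbI (by grind)
    exact ⟨hloc y hyb w hw (hy.adj_of_indep hI hu (hPI w (hPU w hw)) hwv), hyb,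
      fun w hw hwv => hy.adj_of_indep hI hu (hPI w hw) hwv⟩
  -- Injectivity gives `P.card + T.card ≤ S.card - T.card`, while the negated claim gives `S.card ≤
  -- P.card + T.card`. Hence `T` is empty and `y` maps `P` onto `S`.
  have hstruct : ∀ (x : V) (y : V → V), (∀ v ∈ P ∪ T, y v ∈ S \ T) →
      (∀ v ∈ P ∪ T, ¬ G.Adj (y v) v) →
      (∀ v ∈ P ∪ T, v ≠ x → ∀ w ∈ P ∪ T, w ≠ v → G.Adj (y v) w) →
      (∀ v, v ∉ T) ∧ ∀ s ∈ S, ∃ v ∈ P, y v = s := by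
    intro x y hyS hyn hy
    have hinj := injOn_of_missing x hyn hy
    have hle := Finset.card_le_card_of_injOn y hyS hinj
    have hT0 : T = ∅ := Finset.card_eq_zero.1 (by omega)
    subst hT0
    refine ⟨fun v => Finset.notMem_empty v, fun s hsS => ?_⟩
    have himg : (P ∪ ∅).image y = S \ ∅ := by
      refine Finset.eq_of_subset_of_card_le (Finset.image_subset_iff.2 hyS) ?_
      rw [Finset.card_image_of_injOn hinj]
      omega
    simp only [Finset.union_empty, Finset.sdiff_empty] at himg
    exact Finset.mem_image.1 (himg ▸ hsS)
  by_cases hall : ∀ v ∈ P ∪ T, ∃ u ∈ insert b (P ∪ T), ∃ y, G.NearDominates u y v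
  · choose! u hu y hy using hall
    obtain ⟨hT0, hS⟩ := hstruct b y (fun v hv => (hone v hv _ (hu v hv) _ (hy v hv)).1)
      (fun v hv => (hy v hv).not_adj_right)
      (fun v hv _ => (hone v hv _ (hu v hv) _ (hy v hv)).2.2)
    have hSb : ∀ s ∈ S, G.Adj s b := by
      intro s hsS
      obtain ⟨v, hv, rfl⟩ := hS s hsS
      exact (hone v (hPU v hv) _ (hu v (hPU v hv)) _ (hy v (hPU v hv))).2.1
    obtain ⟨v, hv⟩ := Finset.card_pos.1 (show 0 < P.card by omega)
    have hB : ∀ b' ∈ B, b' = b := by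
      intro b' hb'
      by_contra hne
      obtain ⟨c, d, hcd⟩ := h.exists_nearDominates b
      rcases hs.mem_or_mem hcd (hP hv) hb' (by grind) hne with h1 | h1
      · exact hcd.not_adj_left (hSb _ h1)
      · exact hcd.not_adj_right (hSb _ h1)
    have hclique : ∀ v₁ ∈ P, ∀ v₂ ∈ P, ∀ w, G.NearDominates v₁ w v₂ →
        G.Adj (y v₂) (y v₁) := by
      intro v₁ hv₁ v₂ hv₂ w hw
      have h1 := hone v₂ (hPU v₂ hv₂) _ (hPI _ (hPU v₁ hv₁)) w hw
      obtain ⟨v₃, hv₃, rfl⟩ := hS w (Finset.mem_sdiff.1 h1.1).1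
      have h3 := hone v₃ (hPU v₃ hv₃) _ (hu v₃ (hPU v₃ hv₃)) _ (hy v₃ (hPU v₃ hv₃))
      have h4 := hw.not_adj_right
      have h32 : v₂ = v₃ := by
        by_contra hne
        exact h4 (h3.2.2 v₂ (hPU v₂ hv₂) hne)
      subst h32
      have h5 := hone v₁ (hPU v₁ hv₁) _ (hu v₁ (hPU v₁ hv₁)) _ (hy v₁ (hPU v₁ hv₁))
      have h6 := (hy v₁ (hPU v₁ hv₁)).not_adj_right
      have h7 : y v₁ ∈ S := (Finset.mem_sdiff.1 h5.1).1
      rcases hw.dominates (y v₁) (fun e => hAS _ (hP hv₂) (e ▸ h7)) with h8 | h8 | h8 | h8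
      · exact absurd (h8.symm ▸ hAS _ (hP hv₁)) (not_not_intro h7)
      · exact absurd (h8 ▸ hw.adj.symm) h6
      · exact absurd h8.symm h6
      · exact h8
    have hyb := hSb (y v) (Finset.mem_sdiff.1
      (hone v (hPU v hv) _ (hu v (hPU v hv)) _ (hy v (hPU v hv))).1).1
    obtain ⟨z, rfl | hbz, hzy, hyz⟩ := h.exists_adj_not_adj (G.ne_of_adj hyb).symm
    · exact hyz hyb
    have hzS : z ∈ S := by
      have := hcov z
      grind
    obtain ⟨w, hw, rfl⟩ := hS z hzS
    obtain ⟨a, ha, hav, haw⟩ : ∃ a, (∀ v ∈ P, ¬ G.Adj v a) ∧ a ≠ v ∧ a ≠ w :=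
      ⟨b, fun v hv => hAB v (hP hv) b hb, by grind, by grind⟩
    have hvw : v ≠ w := fun e => hzy (e ▸ rfl)
    obtain ⟨u, hu | hu⟩ := h.exists_of_indep v w a hvw hav.symm haw.symm (hPP v hv w hw)
      (ha v hv) (ha w hw)
    · exact hyz (hclique v hv w hw u hu).symm
    · exact hyz (hclique w hw v hv u hu)
  · obtain hcase | ⟨x, hx, hcase⟩ := h.forall_or_exists hI
      (by rw [Finset.card_insert_of_notMem hbPT]; omega)
    · exact hall fun v hv => hcase v (hPI v hv)
    have hxP : x ∈ P ∪ T := by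
      rcases Finset.mem_insert.1 hx with rfl | hx
      · exact absurd (fun v hv => ⟨x, hbI, hcase v (hPI v hv) (by grind)⟩) hall
      · exact hx
    have hbx : b ≠ x := fun e => hbPT (e ▸ hxP)
    obtain ⟨a, ha, hax⟩ := Finset.exists_mem_ne (show 1 < P.card by omega) x
    obtain ⟨c, d, hcd, hcS⟩ : ∃ c d, G.NearDominates c d x ∧ c ∈ S \ T := by
      have key : ∀ c d, G.NearDominates c d x → c ∈ S →
          ∃ c d, G.NearDominates c d x ∧ c ∈ S \ T := by
        intro c d hcd hc
        by_cases hcT : c ∈ T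
        · refine ⟨d, c, hcd.symm, ?_⟩
          have h1 := hcd.dominates a hax
          have h2 := hcd.dominates b hbx
          have h3 := hcd.adj
          have h4 := hcov d
          grind
        · exact ⟨c, d, hcd, Finset.mem_sdiff.2 ⟨hc, hcT⟩⟩
      obtain ⟨c, d, hcd⟩ := h.exists_nearDominates x
      rcases hs.mem_or_mem hcd (hP ha) hb hax hbx with h1 | h1
      · exact key _ _ hcd h1
      · exact key _ _ hcd.symm h1
    choose! y hy using hcase
    -- The exceptional `x` has no partner; an end `c` in `S \ T` of an edge missing `x` takes its
    -- place.
    obtain ⟨hT0, hS⟩ := hstruct x (Function.update y x c)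
      (fun v hv => by
        by_cases hvx : v = x
        · subst hvx
          simpa using hcS
        · rw [Function.update_of_ne hvx]
          exact (hone v hv _ hx _ (hy v (hPI v hv) hvx)).1)
      (fun v hv => by
        by_cases hvx : v = x
        · subst hvx
          simpa using hcd.not_adj_left
        · rw [Function.update_of_ne hvx]
          exact (hy v (hPI v hv) hvx).not_adj_right)
      (fun v hv hvx => by
        rw [Function.update_of_ne hvx]
        exact (hone v hv _ hx _ (hy v (hPI v hv) hvx)).2.2)
    replace hS : ∀ s ∈ S, s = c ∨ ∃ v ∈ P, v ≠ x ∧ y v = s := by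
      intro s hsS
      obtain ⟨v, hv, hvs⟩ := hS s hsS
      by_cases hvx : v = x
      · left
        rw [← hvs, hvx, Function.update_self]
      · rw [Function.update_of_ne hvx] at hvs
        exact .inr ⟨v, hv, hvx, hvs⟩
    have hxP : x ∈ P := by grind
    have hcS : c ∈ S := (Finset.mem_sdiff.1 hcS).1
    have hyx : ∀ v ∈ P, v ≠ x → G.Adj (y v) x := fun v hv hvx =>
      (hy v (hPI v (hPU v hv)) hvx).adj.symm
    have hcx := hcd.not_adj_left
    have hdx := hcd.not_adj_right
    have hyb := hy b hbI hbx
    have hybS : y b ∉ S := by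
      intro hmem
      rcases hS _ hmem with h1 | ⟨v, hv, hvx, hvb⟩
      · exact hcx (h1 ▸ hyb.adj.symm)
      · exact hyb.not_adj_right (hvb ▸ (hone v (hPU v hv) _ hx _ (hy v (hPI v (hPU v hv)) hvx)).2.1)
    have hB : ∀ b' ∈ B, b' = b := by
      intro b' hb'
      by_contra hne
      have h1 := hyb.dominates b' hne
      have h2 := hcov (y b)
      have h3 := hyb.adj
      grind
    have hcb : G.Adj c b := by
      rcases hcd.dominates b hbx with rfl | rfl | h1 | h1
      · exact absurd hcS (hBS _ hb)
      · exact hcd.adj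
      · exact h1
      · exfalso
        rcases hcov d with h2 | h2 | h2
        · exact hAB d h2 b hb h1
        · rcases hS d h2 with h3 | ⟨v, hv, hvx, rfl⟩
          · exact hirr c (h3 ▸ hcd.adj)
          · exact hdx (hyx v hv hvx)
        · exact h1.ne (hB d h2)
    -- Each neighbour of `b` is `c` or some `y w`. The edge from `x` to `y w` dominates `c`, and `x`
    -- is not adjacent to `c`, so `y w` is: `c` dominates the closed neighbourhood of `b`.
    obtain ⟨z, rfl | hbz, hzc, hcz⟩ := h.exists_adj_not_adj hcb.ne'
    · exact hcz hcb
    have hzS : z ∈ S := by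
      have := hcov z
      grind
    rcases hS z hzS with rfl | ⟨w, hw, hwx, rfl⟩
    · exact hzc rfl
    · rcases (hy w (hPI w (hPU w hw)) hwx).dominates c (fun e => hAS w (hP hw) (e ▸ hcS)) with
        h1 | h1 | h1 | h1
      · exact hAS x (hP hxP) (h1 ▸ hcS)
      · exact hzc h1.symm
      · exact hcx h1.symm
      · exact hcz h1.symm

/-- The case of an independent set with at least two elements on each side. -/
lemma IsNearDominated.card_add_card_add_card_le (h : G.IsNearDominated)
    (hs : G.IsSeparation A S B) {P Q T : Finset V} (hP : P ⊆ A) (hQ : Q ⊆ B) (hT : T ⊆ S)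
    (hPP : ∀ u ∈ P, ∀ v ∈ P, ¬ G.Adj u v) (hQQ : ∀ u ∈ Q, ∀ v ∈ Q, ¬ G.Adj u v)
    (hTT : ∀ u ∈ T, ∀ v ∈ T, ¬ G.Adj u v) (hPT : ∀ u ∈ P, ∀ v ∈ T, ¬ G.Adj u v)
    (hQT : ∀ u ∈ Q, ∀ v ∈ T, ¬ G.Adj u v) (hP2 : 2 ≤ P.card) (hQ2 : 2 ≤ Q.card) :
    P.card + Q.card + T.card ≤ S.card := by
  classical
  have hsy : ∀ u v, G.Adj u v → G.Adj v u := fun u v => G.adj_symm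
  have hcard : (S \ T).card + T.card = S.card := Finset.card_sdiff_add_card_eq_card hT
  have hcov := hs.cover
  have hAB := hs.not_adj
  have hAS := hs.left_sep
  have hBS := hs.right_sep
  have hdisj := hs.left_right
  have hPQ : (P ∪ Q).card = P.card + Q.card :=
    Finset.card_union_of_disjoint (Finset.disjoint_left.2 fun v hv hv' => hdisj v (hP hv) (hQ hv'))
  have hI : ∀ u ∈ P ∪ Q, ∀ v ∈ P ∪ Q, ¬ G.Adj u v := by grind
  have hloc : ∀ y, ∀ v ∈ P, G.Adj y v → ∀ w ∈ Q, G.Adj y w → y ∈ S \ T := by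
    intro y v hv hyv w hw hyw
    have := hcov y
    grind
  have hone : ∀ v ∈ P ∪ Q, ∀ u ∈ P ∪ Q, ∀ y, G.NearDominates u y v →
      y ∈ S \ T ∧ ¬ G.Adj y v ∧ ∀ w ∈ P ∪ Q, w ≠ v → G.Adj y w := by
    intro v hv u hu y hy
    -- Two elements on each side leave one on each side after removing `v`, so the partner is
    -- adjacent to both sides.
    obtain ⟨p, hp, hpv⟩ := Finset.exists_mem_ne (show 1 < P.card by omega) v
    obtain ⟨q, hq, hqv⟩ := Finset.exists_mem_ne (show 1 < Q.card by omega) v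
    exact ⟨hloc y p hp (hy.adj_of_indep hI hu (Finset.mem_union_left _ hp) hpv) q hq
      (hy.adj_of_indep hI hu (Finset.mem_union_right _ hq) hqv), hy.not_adj_right,
      fun w hw hwv => hy.adj_of_indep hI hu hw hwv⟩
  have hmiss : ∀ x, ∃ c ∈ S \ T, ¬ G.Adj c x := by
    intro x
    obtain ⟨p, hp, hpx⟩ := Finset.exists_mem_ne (show 1 < P.card by omega) x
    obtain ⟨q, hq, hqx⟩ := Finset.exists_mem_ne (show 1 < Q.card by omega) x
    have key : ∀ c d, G.NearDominates c d x → c ∈ S → ∃ c ∈ S \ T, ¬ G.Adj c x := by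
      intro c d hcd hc
      by_cases hcT : c ∈ T
      · refine ⟨d, ?_, hcd.not_adj_right⟩
        have h1 := hcd.dominates p hpx
        have h2 := hcd.dominates q hqx
        have h3 := hcd.adj
        have h4 := hcov d
        grind
      · exact ⟨c, Finset.mem_sdiff.2 ⟨hc, hcT⟩, hcd.not_adj_left⟩
    obtain ⟨c, d, hcd⟩ := h.exists_nearDominates x
    rcases hs.mem_or_mem hcd (hP hp) (hQ hq) hpx hqx with h1 | h1
    · exact key _ _ hcd h1
    · exact key _ _ hcd.symm h1
  suffices (P ∪ Q).card ≤ (S \ T).card by omega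
  rcases h.forall_or_exists hI (by omega) with hcase | ⟨x, hx, hcase⟩
  · obtain ⟨x, -⟩ := hs.left_nonempty
    refine card_le_of_missing (G := G) x fun v hv => ?_
    obtain ⟨u, hu, y, hy⟩ := hcase v hv
    have := hone v hv u hu y hy
    exact ⟨y, this.1, this.2.1, fun _ => this.2.2⟩
  · refine card_le_of_missing (G := G) x fun v hv => ?_
    by_cases hvx : v = x
    · obtain ⟨c, hc, hcv⟩ := hmiss v
      exact ⟨c, hc, hcv, fun hvx' => absurd hvx hvx'⟩
    · obtain ⟨y, hy⟩ := hcase v hv hvx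
      have := hone v hv x hx y hy
      exact ⟨y, this.1, this.2.1, fun _ => this.2.2⟩

end Cases

/-! ### The inequality for separations, cut sets and the connectivity. -/

lemma IsNearDominated.card_le_of_isSeparation (h : G.IsNearDominated) {A S B I : Finset V}
    (hs : G.IsSeparation A S B) (hI : G.IsIndepSet I) : I.card ≤ S.card := by
  classical
  replace hI : ∀ u ∈ I, ∀ v ∈ I, ¬ G.Adj u v := fun u hu v hv e => hI hu hv e.ne e
  have h2 := h.two_le_card hs
  by_cases hI3 : I.card ≤ 2
  · omega
  wlog hle : (I.filter (· ∈ B)).card ≤ (I.filter (· ∈ A)).card generalizing A B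
  · exact this hs.symm (by omega)
  have hcov := hs.cover
  have hdisj := hs.left_right
  have hAS := hs.left_sep
  have hBS := hs.right_sep
  have hsum : I.card = (I.filter (· ∈ A)).card + (I.filter (· ∈ B)).card +
      (I.filter (· ∈ S)).card := by
    rw [← Finset.card_union_of_disjoint, ← Finset.card_union_of_disjoint]
    · congr 1
      grind
    · rw [Finset.disjoint_left]
      grind
    · rw [Finset.disjoint_left]
      grind
  have hAA : I.filter (· ∈ A) ⊆ A := fun v hv => (Finset.mem_filter.1 hv).2
  have hBB : I.filter (· ∈ B) ⊆ B := fun v hv => (Finset.mem_filter.1 hv).2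
  have hSS : I.filter (· ∈ S) ⊆ S := fun v hv => (Finset.mem_filter.1 hv).2
  have hsub : ∀ (p q : V → Prop) [DecidablePred p] [DecidablePred q],
      ∀ u ∈ I.filter p, ∀ v ∈ I.filter q, ¬ G.Adj u v := fun p q _ _ u hu v hv =>
    hI u (Finset.mem_filter.1 hu).1 v (Finset.mem_filter.1 hv).1
  have hSc := Finset.card_le_card hSS
  rcases (by omega : (I.filter (· ∈ B)).card = 0 ∨ (I.filter (· ∈ B)).card = 1 ∨
    2 ≤ (I.filter (· ∈ B)).card) with hB0 | hB1 | hB2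
  · rcases (by omega : (I.filter (· ∈ A)).card = 0 ∨ (I.filter (· ∈ A)).card = 1 ∨
      2 ≤ (I.filter (· ∈ A)).card) with hA0 | hA1 | hA2
    · omega
    · obtain ⟨x, hx⟩ := Finset.card_pos.1 (show 0 < (I.filter (· ∈ A)).card by omega)
      have := h.card_lt_of_singleton hs (hAA hx) hSS (hsub _ _) (hsub _ _ x hx) (by omega)
      omega
    · have := h.card_add_card_le hs hAA hSS (hsub _ _) (hsub _ _) hA2
      omega
  · obtain ⟨b, hb⟩ := Finset.card_pos.1 (show 0 < (I.filter (· ∈ B)).card by omega)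
    obtain ⟨a, ha⟩ := Finset.card_pos.1 (show 0 < (I.filter (· ∈ A)).card by omega)
    rcases (by omega : (I.filter (· ∈ A)).card = 1 ∨ 2 ≤ (I.filter (· ∈ A)).card) with hA1 | hA2
    · have := h.card_add_two_le hs (hAA ha) (hBB hb) hSS (hsub _ _) (hsub _ _ a ha)
        (hsub _ _ b hb) (by omega)
      omega
    · have := h.card_add_card_lt hs (hBB hb) hAA hSS (hsub _ _) (hsub _ _) (hsub _ _)
        (hsub _ _ b hb) hA2
      omega
  · have := h.card_add_card_add_card_le hs hAA hBB hSS (hsub _ _) (hsub _ _) (hsub _ _)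
      (hsub _ _) (hsub _ _) (by omega) hB2
    omega

lemma IsCutSet.exists_isSeparation [Finite V] {S : Finset V} (h : G.IsCutSet S) :
    ∃ A B, G.IsSeparation A S B := by
  classical
  have := Fintype.ofFinite V
  simp only [IsCutSet, Preconnected, not_forall] at h
  obtain ⟨⟨a, ha⟩, ⟨b, hb⟩, hab⟩ := h
  have ha' : a ∉ S := ha
  have hb' : b ∉ S := hb
  let R : V → Prop := fun v => ∃ hv : v ∈ ((S : Set V)ᶜ),
    (G.induce ((S : Set V)ᶜ)).Reachable ⟨a, ha⟩ ⟨v, hv⟩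
  refine ⟨Finset.univ.filter fun v => v ∉ S ∧ R v, Finset.univ.filter fun v => v ∉ S ∧ ¬ R v,
    ⟨a, ?_⟩, ⟨b, ?_⟩, ?_, ?_, ?_, ?_, ?_⟩
  · simpa using ⟨ha', ha, Reachable.rfl⟩
  · simpa using ⟨hb', fun ⟨_, h⟩ => hab h⟩
  · intro v
    simp only [Finset.mem_filter, Finset.mem_univ, true_and]
    tauto
  · simp +contextual
  · simp +contextual
  · simp +contextual
  · simp only [Finset.mem_filter, Finset.mem_univ, true_and]
    rintro u ⟨-, hu, hu'⟩ v ⟨hv, hv'⟩ huv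
    refine hv' ⟨hv, hu'.trans (Adj.reachable ?_)⟩
    exact huv

theorem IsMaximalVertexCritical.indepNum_le [Finite V] (h : G.IsMaximalVertexCritical 3) :
    G.indepNum ≤ G.vertexConnectivity := by
  classical
  have := Fintype.ofFinite V
  obtain ⟨I, hI, hIc⟩ := G.exists_isNIndepSet_indepNum
  rw [← hIc]
  refine le_csInf ⟨_, Finset.univ, rfl, .inr (by simp)⟩ ?_
  rintro k ⟨S, rfl, hS | hS⟩
  · obtain ⟨A, B, hs⟩ := hS.exists_isSeparation
    exact h.isNearDominated.card_le_of_isSeparation hs hI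
  · rcases I.eq_empty_or_nonempty with rfl | ⟨c, hc⟩
    · simp
    obtain ⟨e, f, hef⟩ := h.isNearDominated.exists_nearDominates c
    -- If at most one vertex remains, `S` has at least `n - 1` vertices; `I` is not everything
    -- because `G` has an edge.
    have hlt : I.card < Fintype.card V := by
      by_contra! hle
      have hu := (Finset.card_eq_iff_eq_univ I).1 (le_antisymm (Finset.card_le_univ I) hle)
      exact hI (by simp [hu]) (by simp [hu]) hef.adj.ne hef.adj
    have h1 : Sᶜ.card ≤ 1 := by
      rw [Finset.card_le_one]
      intro a ha b hb
      exact hS (by simpa using ha) (by simpa using hb)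
    rw [Finset.card_compl] at h1
    omega

/-! ### The extremal graphs. -/

variable {l : ℕ}

lemma gOne_isMaximalVertexCritical (hl : 2 ≤ l) : (gOne l).IsMaximalVertexCritical 3 := by
  have hex : ∀ i : Fin l, ∃ j : Fin l, j ≠ i := fun i => by
    have : Nontrivial (Fin l) := Fin.nontrivial_iff_two_le.2 hl
    exact exists_ne i
  have h0 : 0 < l := by omega
  have h3 : (gOne l).connectedDominationNumber = 3 := by
    apply le_antisymm
    · let z : Fin l := ⟨0, by omega⟩
      obtain ⟨q, hq⟩ := hex z
      have hD : (gOne l).IsConnectedDominatingSet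
          {.inl (), .inr (.inl z), .inr (.inr q)} := by
        refine ⟨?_, ?_⟩
        · rintro (_ | i | i)
          · simp
          · exact .inr ⟨.inl (), by simp, trivial⟩
          · by_cases hi : i = q
            · simp [hi]
            · exact .inr ⟨.inr (.inr q), by simp, Ne.symm hi⟩
        · have hset : ((({.inl (), .inr (.inl z), .inr (.inr q)} :
              Finset (Unit ⊕ Fin l ⊕ Fin l)) : Set (Unit ⊕ Fin l ⊕ Fin l))) =
              {.inl (), .inr (.inl z)} ∪ {.inr (.inl z), .inr (.inr q)} := by
            ext; simp; tauto
          rw [hset]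
          refine induce_union_connected ?_ ?_ ⟨.inr (.inl z), by simp⟩
          · exact (induce_pair_connected_of_adj trivial).preconnected
          · exact (induce_pair_connected_of_adj (show (gOne l).Adj (.inr (.inl z)) (.inr (.inr q)) from hq.symm)).preconnected
      refine (iInf₂_le _ hD).trans ?_
      exact_mod_cast Finset.card_le_three
    · by_contra! hlt
      obtain ⟨c, d, hcd, hdom⟩ := connectedDominationNumber_lt_three_iff.1 hlt
      rcases c with _ | i | i <;> rcases d with _ | j | j
      · simpa [gOne] using hdom (.inr (.inr ⟨0, h0⟩))
      · simpa [gOne] using hdom (.inr (.inr j))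
      · simp [gOne] at hcd
      · simpa [gOne] using hdom (.inr (.inr i))
      · obtain rfl : i = j := by simpa [gOne] using hcd
        simpa [gOne] using hdom (.inr (.inr i))
      · have hij : i ≠ j := by simpa [gOne] using hcd
        simpa [gOne, hij.symm] using hdom (.inr (.inl j))
      · simp [gOne] at hcd
      · have hij : i ≠ j := by simpa [gOne] using hcd
        simpa [gOne, hij] using hdom (.inr (.inl i))
      · simpa [gOne] using hdom (.inl ())
  refine ⟨⟨h3, ?_⟩, h3, ?_⟩
  · intro u v huv hadj
    refine connectedDominationNumber_lt_three_iff.2 ?_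
    have hvq : ∀ j : Fin l, ∃ c d, (c = d ∨ (gOne l ⊔ edge (.inl ()) (.inr (.inr j))).Adj c d) ∧
        ∀ u, u = c ∨ u = d ∨ (gOne l ⊔ edge (.inl ()) (.inr (.inr j))).Adj c u ∨
          (gOne l ⊔ edge (.inl ()) (.inr (.inr j))).Adj d u := by
      intro j
      refine ⟨.inl (), .inr (.inr j), ?_, ?_⟩
      · simp [edge_adj]
      · rintro (_ | i | i)
        · simp
        · simp [gOne]
        · by_cases hij : i = j
          · simp [edge_adj, gOne, hij]
          · simp [gOne, Ne.symm hij]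
    have hzq : ∀ j : Fin l, ∃ c d,
        (c = d ∨ (gOne l ⊔ edge (.inr (.inl j)) (.inr (.inr j))).Adj c d) ∧
        ∀ u, u = c ∨ u = d ∨ (gOne l ⊔ edge (.inr (.inl j)) (.inr (.inr j))).Adj c u ∨
          (gOne l ⊔ edge (.inr (.inl j)) (.inr (.inr j))).Adj d u := by
      intro j
      refine ⟨.inr (.inl j), .inr (.inr j), ?_, ?_⟩
      · simp [edge_adj]
      · rintro (_ | i | i)
        · simp [gOne]
        · by_cases hij : i = j
          · simp [edge_adj, gOne, hij]
          · simp [gOne, Ne.symm hij]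
        · by_cases hij : i = j
          · simp [edge_adj, gOne, hij]
          · simp [gOne, Ne.symm hij]
    rcases u with _ | i | i <;> rcases v with _ | j | j
    · exact absurd rfl huv
    · simp [gOne] at hadj
    · exact hvq j
    · simp [gOne] at hadj
    · have hij : i ≠ j := by simpa using huv
      refine ⟨.inr (.inl i), .inr (.inr j), ?_, ?_⟩
      · simp [gOne, hij]
      · rintro (_ | k | k)
        · simp [gOne]
        · by_cases hkj : k = j
          · simp [edge_adj, hij, hkj]
          · simp [gOne, Ne.symm hkj]
        · by_cases hkj : k = j
          · simp [edge_adj, gOne, hkj]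
          · simp [gOne, Ne.symm hkj]
    · obtain rfl : i = j := by simpa [gOne] using hadj
      exact hzq i
    · rw [edge_comm]
      exact hvq i
    · obtain rfl : i = j := by simpa [gOne] using hadj
      rw [edge_comm]
      exact hzq i
    · exact absurd (show i ≠ j by simpa using huv) hadj
  · intro v
    refine connectedDominationNumber_lt_three_iff.2 ?_
    simp only [Subtype.exists, Subtype.forall, Subtype.mk.injEq, comap_adj,
      Function.Embedding.subtype_apply, Set.mem_compl_iff, Set.mem_singleton_iff]
    rcases v with _ | i | i
    · obtain ⟨q, hq⟩ := hex ⟨0, h0⟩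
      refine ⟨.inr (.inr ⟨0, h0⟩), by simp, .inr (.inr q), by simp, .inr hq.symm, ?_⟩
      rintro (_ | k | k) hk
      · simp at hk
      · by_cases hkq : k = q
        · simp [gOne, hkq, hq.symm]
        · simp [gOne, Ne.symm hkq]
      · by_cases hkq : k = q
        · simp [hkq]
        · simp [gOne, Ne.symm hkq]
    · obtain ⟨j, hj⟩ := hex i
      refine ⟨.inr (.inl j), by simpa using hj, .inr (.inr i), by simp, .inr hj, ?_⟩
      rintro (_ | k | k) hk
      · simp [gOne]
      · have hki : k ≠ i := by simpa using hk
        simp [gOne, hki.symm]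
      · by_cases hki : k = i
        · simp [hki]
        · simp [gOne, Ne.symm hki]
    · refine ⟨.inl (), by simp, .inr (.inl i), by simp, .inr trivial, ?_⟩
      rintro (_ | k | k) hk
      · simp
      · simp [gOne]
      · have hki : k ≠ i := by simpa using hk
        simp [gOne, hki.symm]

lemma gOne_indepNum (hl : 2 ≤ l) : (gOne l).indepNum = l := by
  classical
  apply le_antisymm
  · obtain ⟨I, hI, hIc⟩ := (gOne l).exists_isNIndepSet_indepNum
    rw [← hIc]
    replace hI : ∀ u ∈ I, ∀ v ∈ I, ¬ (gOne l).Adj u v := fun u hu v hv e => hI hu hv e.ne e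
    by_cases hq : ∃ i, .inr (.inr i) ∈ I
    · obtain ⟨i, hi⟩ := hq
      by_contra! hlt
      -- An independent set containing `q i` can otherwise contain only one of `v` and `z i`, hence
      -- has at most `2 ≤ l` elements.
      have hsub : ∃ w : Unit ⊕ Fin l ⊕ Fin l, I ⊆ {w, .inr (.inr i)} := by
        have hq : ∀ j, .inr (.inr j) ∈ I → j = i := fun j hj => by
          by_contra hne
          exact hI _ hj _ hi hne
        have hz : ∀ j, .inr (.inl j) ∈ I → j = i := fun j hj => by
          by_contra hne
          exact hI _ hj _ hi hne
        by_cases hv : .inl () ∈ I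
        · refine ⟨.inl (), ?_⟩
          rintro (_ | j | j) hj
          · simp
          · exact absurd trivial (hI _ hv _ hj)
          · simp [hq j hj]
        · refine ⟨.inr (.inl i), ?_⟩
          rintro (_ | j | j) hj
          · exact absurd hj hv
          · simp [hz j hj]
          · simp [hq j hj]
      obtain ⟨w, hw⟩ := hsub
      have := (Finset.card_le_card hw).trans Finset.card_le_two
      omega
    · by_cases hv : .inl () ∈ I
      · have : I ⊆ {.inl ()} := by
          rintro (_ | i | i) hi
          · simp
          · exact absurd trivial (hI _ hv _ hi)
          · exact absurd ⟨i, hi⟩ hq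
        have := Finset.card_le_card this
        rw [Finset.card_singleton] at this
        omega
      · have : I ⊆ Finset.univ.image fun i => .inr (.inl i) := by
          rintro (_ | i | i) hi
          · exact absurd hi hv
          · simp
          · exact absurd ⟨i, hi⟩ hq
        simpa using (Finset.card_le_card this).trans Finset.card_image_le
  · have hI : (gOne l).IsIndepSet
        ((Finset.univ.image fun i => .inr (.inl i) : Finset (Unit ⊕ Fin l ⊕ Fin l)) :
          Set (Unit ⊕ Fin l ⊕ Fin l)) := by
      intro u hu v hv _
      simp only [Finset.coe_image, Finset.coe_univ, Set.image_univ, Set.mem_range] at hu hv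
      obtain ⟨i, rfl⟩ := hu
      obtain ⟨j, rfl⟩ := hv
      exact id
    have := hI.card_le_indepNum
    rwa [Finset.card_image_of_injective _ (fun i j h => by simpa using h),
      Finset.card_univ, Fintype.card_fin] at this

/-- Deleting all `z i` isolates `v`. The reverse inequality comes from the general bound and
`gOne_indepNum`. -/
lemma gOne_vertexConnectivity_le (hl : 2 ≤ l) : (gOne l).vertexConnectivity ≤ l := by
  classical
  refine Nat.sInf_le ⟨Finset.univ.image fun i => .inr (.inl i), ?_, .inl fun hpre => ?_⟩
  · rw [Finset.card_image_of_injective _ (fun i j h => by simpa using h),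
      Finset.card_univ, Fintype.card_fin]
  · have hv : (Sum.inl () : Unit ⊕ Fin l ⊕ Fin l) ∈
        (((Finset.univ.image fun i => .inr (.inl i) : Finset (Unit ⊕ Fin l ⊕ Fin l)) :
          Set (Unit ⊕ Fin l ⊕ Fin l))ᶜ) := by simp
    have hq : (Sum.inr (Sum.inr ⟨0, by omega⟩) : Unit ⊕ Fin l ⊕ Fin l) ∈
        (((Finset.univ.image fun i => .inr (.inl i) : Finset (Unit ⊕ Fin l ⊕ Fin l)) :
          Set (Unit ⊕ Fin l ⊕ Fin l))ᶜ) := by simp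
    have : Nontrivial ((((Finset.univ.image fun i => .inr (.inl i) :
        Finset (Unit ⊕ Fin l ⊕ Fin l)) : Set (Unit ⊕ Fin l ⊕ Fin l))ᶜ : Set _)) :=
      ⟨⟨_, hv⟩, ⟨_, hq⟩, by simp⟩
    obtain ⟨⟨u, hu⟩, hadj⟩ := hpre.exists_adj_of_nontrivial ⟨_, hv⟩
    have hadj : (gOne l).Adj (.inl ()) u := hadj
    rcases u with _ | i | i
    · exact hadj
    · simp at hu
    · exact hadj

end SimpleGraph

theorem theorem4p1 :
    (∀ {V : Type*} [Finite V] (G : SimpleGraph V),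
      G.IsMaximalVertexCritical 3 → G.indepNum ≤ G.vertexConnectivity) ∧
    (∀ l : ℕ, 2 ≤ l →
      (SimpleGraph.gOne l).IsMaximalVertexCritical 3 ∧
      (SimpleGraph.gOne l).indepNum = l ∧
      (SimpleGraph.gOne l).vertexConnectivity = l) := by
  refine ⟨fun G h => h.indepNum_le, fun l hl => ?_⟩
  have hmax := SimpleGraph.gOne_isMaximalVertexCritical hl
  have hind := SimpleGraph.gOne_indepNum hl
  exact ⟨hmax, hind, le_antisymm (SimpleGraph.gOne_vertexConnectivity_le hl)
    (hind.ge.trans hmax.indepNum_le)⟩
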